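/- For a commutative Noetherian ring $R$, let $D^b(\mathrm{Coh}(\operatorname{Spec} R))$ be the bounded derived category of coherent sheaves on $\operatorname{Spec} R$ (equivalently, of finitely generated $R$-modules), and let $D_{\mathrm{perf}}(R)$ be its full subcategory of perfect objects, i.e. those which are locally on $\operatorname{Spec} R$ represented by bounded complexes of finite locally free sheaves. Let $K_0'(R)$ (respectively $K_0(R)$) be the free abelian group on the objects of $D^b(\mathrm{Coh}(\operatorname{Spec} R))$ (respectively $D_{\mathrm{perf}}(R)$) modulo the relations $[Y]-[X]-[Z]$ for all distinguished triangles $X\to Y\to Z\to X[1]$ in that category, and let $K_0(R)\to K_0'(R)$ be the natural homomorphism $[X]\mapsto[X]$. **Proposition.** Let $A$ be a regular ring (a commutative Noetherian ring all of whose localizations at prime ideals are regular local rings), and let $B=A[z]/(z^2)$ be the ring of dual numbers over $A$. Then the image of the natural homomorphism $K_0(B)\to K_0'(B)$ is $2K_0'(B)=\{2x : x\in K_0'(B)\}$. -/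

import Mathlib

open CategoryTheory CategoryTheory.Limits CategoryTheory.Pretriangulated
open scoped Polynomial

universe w v u

noncomputable section

namespace TriangulatedKTheory

variable {C : Type u} [Category.{v} C] [HasZeroObject C] [HasShift C ℤ] [Preadditive C]
  [∀ n : ℤ, (shiftFunctor C n).Additive] [Pretriangulated C]

/-- The relations `[Y] - [X] - [Z]`, one for each distinguished triangle `X ⟶ Y ⟶ Z ⟶ X⟦1⟧`
whose three vertices lie in the full subcategory of `C` given by `P`. -/
def triangleRelations (P : ObjectProperty C) : Set (FreeAbelianGroup P.FullSubcategory) :=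
  {r | ∃ (X Y Z : P.FullSubcategory) (f : X.obj ⟶ Y.obj) (g : Y.obj ⟶ Z.obj)
      (h : Z.obj ⟶ (shiftFunctor C (1 : ℤ)).obj X.obj),
      Triangle.mk f g h ∈ distTriang C ∧
      r = FreeAbelianGroup.of Y - FreeAbelianGroup.of X - FreeAbelianGroup.of Z}

/-- The Grothendieck group of the full subcategory of the triangulated category `C` given by `P`:
the free abelian group on its objects modulo the relations coming from distinguished triangles. -/
abbrev K₀ (P : ObjectProperty C) : Type u :=
  FreeAbelianGroup P.FullSubcategory ⧸ AddSubgroup.closure (triangleRelations P)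

/-- The class of an object in the Grothendieck group. -/
def K₀.mk {P : ObjectProperty C} (X : C) (hX : P X) : K₀ P :=
  QuotientAddGroup.mk (FreeAbelianGroup.of (⟨X, hX⟩ : P.FullSubcategory))

/-- The homomorphism on Grothendieck groups induced by an inclusion of full subcategories;
it sends `[X]` to `[X]`. -/
def K₀.map {P P' : ObjectProperty C} (h : P ≤ P') : K₀ P →+ K₀ P' :=
  QuotientAddGroup.map _ _ (FreeAbelianGroup.map (ObjectProperty.ιOfLE h).obj) <| by
    rw [AddSubgroup.closure_le]
    rintro _ ⟨X, Y, Z, f, g, k, hT, rfl⟩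
    exact AddSubgroup.subset_closure
      ⟨(ObjectProperty.ιOfLE h).obj X, (ObjectProperty.ιOfLE h).obj Y,
        (ObjectProperty.ιOfLE h).obj Z, f, g, k, hT, by simp [FreeAbelianGroup.map_of_apply]⟩

theorem K₀.map_mk {P P' : ObjectProperty C} (h : P ≤ P') (X : C) (hX : P X) :
    K₀.map h (K₀.mk X hX) = K₀.mk X (h X hX) := rfl

end TriangulatedKTheory

section Ring

variable (R : Type u) [CommRing R]

/-- A strictly perfect complex of `R`-modules: a bounded complex of finitely generated
projective (that is, finite locally free) modules. -/
def IsStrictlyPerfect (L : CochainComplex (ModuleCat.{u} R) ℤ) : Prop :=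
  (∃ a b : ℤ, L.IsStrictlyGE a ∧ L.IsStrictlyLE b) ∧
    ∀ i : ℤ, Module.Finite R (L.X i) ∧ Module.Projective R (L.X i)

variable [IsNoetherianRing R]

/-- The exact functor `M ↦ M_f` from finitely generated `R`-modules (coherent sheaves on `Spec R`)
to `R_f`-modules, that is, restriction to the basic open subset `D(f)`. -/
def restrictToBasicOpen (f : R) :
    FGModuleCat.{u} R ⥤ ModuleCat.{u} (Localization (Submonoid.powers f)) :=
  forget₂ (FGModuleCat.{u} R) (ModuleCat.{u} R) ⋙
    ModuleCat.localizedModuleFunctor (Submonoid.powers f)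

instance (f : R) : (restrictToBasicOpen R f).Additive where
  map_add {X Y g h} := by
    exact (ModuleCat.localizedModuleFunctor (Submonoid.powers f)).map_add
      (f := (forget₂ (FGModuleCat.{u} R) (ModuleCat.{u} R)).map g)
      (g := (forget₂ (FGModuleCat.{u} R) (ModuleCat.{u} R)).map h)

/-- A complex of finitely generated `R`-modules is perfect if `Spec R` has a covering by basic open
subsets `D(f)` over each of which the complex receives a quasi-isomorphism from a strictly perfect
complex. -/
def IsPerfectComplex (K : CochainComplex (FGModuleCat.{u} R) ℤ) : Prop :=
  ∃ s : Set R, Ideal.span s = ⊤ ∧ ∀ f ∈ s,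
    ∃ L : CochainComplex (ModuleCat.{u} (Localization (Submonoid.powers f))) ℤ,
      IsStrictlyPerfect (Localization (Submonoid.powers f)) L ∧
      ∃ φ : L ⟶ ((restrictToBasicOpen R f).mapHomologicalComplex (ComplexShape.up ℤ)).obj K,
        QuasiIso φ

variable [HasDerivedCategory.{w} (FGModuleCat.{u} R)]

/-- The objects of the bounded derived category `D^b(Coh(Spec R))` inside the derived category of
finitely generated `R`-modules. -/
def boundedObjects : ObjectProperty (DerivedCategory (FGModuleCat.{u} R)) :=
  DerivedCategory.TStructure.t.bounded

/-- The perfect objects of the bounded derived category `D^b(Coh(Spec R))`: those represented by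
a perfect complex. -/
def perfectObjects : ObjectProperty (DerivedCategory (FGModuleCat.{u} R)) := fun X =>
  boundedObjects R X ∧
    ∃ K : CochainComplex (FGModuleCat.{u} R) ℤ,
      IsPerfectComplex R K ∧ Nonempty (X ≅ DerivedCategory.Q.obj K)

theorem perfectObjects_le_boundedObjects : perfectObjects.{w} R ≤ boundedObjects.{w} R :=
  fun _ h => h.1

/-- `K₀'(R)`, the Grothendieck group of the bounded derived category of coherent sheaves
on `Spec R`. -/
abbrev RingK₀' := TriangulatedKTheory.K₀ (boundedObjects.{w} R)

/-- `K₀(R)`, the Grothendieck group of the category of perfect objects. -/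
abbrev RingK₀ := TriangulatedKTheory.K₀ (perfectObjects.{w} R)

/-- The natural map `K₀(R) → K₀'(R)` sending `[X]` to `[X]`. -/
def ringK₀Inclusion : RingK₀.{w} R →+ RingK₀'.{w} R :=
  TriangulatedKTheory.K₀.map (perfectObjects_le_boundedObjects.{w} R)

end Ring

/-- The dual numbers `A[z]/(z²)` over `A`. -/
abbrev DualNumbersOver (A : Type u) [CommRing A] : Type u :=
  A[X] ⧸ Ideal.span {(Polynomial.X ^ 2 : A[X])}

end

/-!
The argument works for any square-zero extension `B` of a regular ring `A` with a retraction
`π : B → A` whose kernel `(z)` is the annihilator of `z`. Write `[M]` for the class in `K₀'(B)` of a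
finitely generated module placed in degree `0`; truncation shows that these classes generate
`K₀'(B)` (`eq_top_of_moduleClass_mem`).

*The image is contained in `2K₀'(B)`.* The class of a perfect complex is a combination of classes of
finitely generated projective modules `P` (`classIn_of_perfectObjects`), and for such a `P`
multiplication by `z` induces `P/zP ≅ zP`, so that `[P] = 2[P/zP]` (`moduleClass_eq_two_nsmul`).

Perfect complexes are only locally represented by bounded complexes of projectives. The global
statement is obtained from `DerivedCategory.ProjAmplitudeGE`, left orthogonality to the complexes
concentrated in degrees below a bound. Killing the top cohomology by projectives shortens the local
projective amplitude until it is concentrated in one degree, where the complex is locally a direct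
summand of a projective module, hence a projective module because projectivity is local.

*`2K₀'(B)` is contained in the image.* The filtration `0 ⊆ zM ⊆ M` reduces to modules `M` killed by
`z`, that is, to `A`-modules. If `M` is projective over `A`, then `B ⊗[A] M` is projective over `B`
with `(B ⊗[A] M)/z ≅ M`, so `2[M] = [B ⊗[A] M]` lies in the image. In general `M` has finite
projective dimension over `A` (`IsRegularRing.exists_hasProjectiveDimensionLE`), and additivity of
`[-]` along a projective resolution reduces to the projective case.

Finiteness of the projective dimension is proved for regular local rings by dividing out a regular
parameter. It then follows in general, without a bound on the Krull dimension, because the locus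
where the projective dimension is at most `n` is open and the spectrum is quasi-compact.
-/

/-! ### Finite projective dimension over regular rings -/

section RegularRing

open IsLocalRing

/-- If `x ∈ 𝔪 ∖ 𝔪²` in a Noetherian local ring, then `x` is part of a minimal generating set of
`𝔪`, so the maximal ideal of `R ⧸ (x)` needs one generator less. -/
lemma IsLocalRing.spanFinrank_maximalIdeal_quotient_lt {R : Type*} [CommRing R] [IsLocalRing R]
    [IsNoetherianRing R] {x : R} (hx : x ∈ maximalIdeal R) (hx2 : x ∉ maximalIdeal R ^ 2)
    [IsLocalRing (R ⧸ Ideal.span {x})] :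
    (maximalIdeal (R ⧸ Ideal.span {x})).spanFinrank < (maximalIdeal R).spanFinrank := by
  classical
  obtain ⟨s, hcard, hs⟩ :=
    Submodule.FG.exists_span_finset_card_eq_spanFinrank (maximalIdeal R).fg_of_isNoetherianRing
  have hxs : x ∈ Submodule.span R (s : Set R) := hs ▸ hx
  obtain ⟨c, -, hc⟩ := Submodule.mem_span_finset.mp hxs
  have hsm : ∀ g ∈ s, g ∈ maximalIdeal R := fun g hg => hs ▸ Submodule.subset_span hg
  -- Some generator `g` occurs in `x` with a unit coefficient, since otherwise `x ∈ 𝔪²`.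
  obtain ⟨g, hg, hgu⟩ : ∃ g ∈ s, IsUnit (c g) := by
    by_contra! h
    refine hx2 (hc ▸ Ideal.sum_mem _ fun a ha => ?_)
    rw [pow_two]
    exact Ideal.mul_mem_mul ((mem_maximalIdeal _).mpr (h a ha)) (hsm a ha)
  have hmap : maximalIdeal (R ⧸ Ideal.span {x}) =
      Ideal.span (Ideal.Quotient.mk (Ideal.span {x}) '' (s.erase g : Set R)) := by
    have hm : maximalIdeal (R ⧸ Ideal.span {x}) =
        (maximalIdeal R).map (Ideal.Quotient.mk (Ideal.span {x})) :=
      (eq_maximalIdeal ((Ideal.map_eq_top_or_isMaximal_of_surjective _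
        Ideal.Quotient.mk_surjective (maximalIdeal.isMaximal R)).resolve_left fun h => by
          have := Ideal.comap_map_of_surjective' (Ideal.Quotient.mk (Ideal.span {x}))
            Ideal.Quotient.mk_surjective (maximalIdeal R)
          rw [h, Ideal.comap_top, Ideal.mk_ker, sup_of_le_left
            ((Ideal.span_singleton_le_iff_mem _).mpr hx)] at this
          exact (maximalIdeal.isMaximal R).ne_top this.symm)).symm
    rw [hm, ← Ideal.map_span]
    refine le_antisymm ?_ (Ideal.map_mono ?_)
    · rw [← hs, ← Ideal.span, Ideal.map_span, Ideal.span_le]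
      rintro _ ⟨a, ha, rfl⟩
      by_cases hag : a = g
      · subst hag
        obtain ⟨u, hu⟩ := hgu
        have h0 : Ideal.Quotient.mk (Ideal.span {x}) (∑ a ∈ s, c a • a) = 0 := by
          rw [hc]
          exact Ideal.Quotient.eq_zero_iff_mem.mpr (Ideal.mem_span_singleton_self x)
        rw [← Finset.add_sum_erase _ _ hg, map_add, add_eq_zero_iff_eq_neg, smul_eq_mul,
          map_mul, ← hu] at h0
        have : Ideal.Quotient.mk (Ideal.span {x}) a = Ideal.Quotient.mk (Ideal.span {x}) (↑u⁻¹) *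
            -(Ideal.Quotient.mk (Ideal.span {x}) (∑ b ∈ s.erase a, c b • b)) := by
          rw [← h0, ← mul_assoc, ← map_mul, Units.inv_mul, map_one, one_mul]
        rw [this]
        refine Ideal.mul_mem_left _ _ (neg_mem (Ideal.mem_map_of_mem _ ?_))
        exact Ideal.sum_mem _ fun b hb => Ideal.mul_mem_left _ _ (Ideal.subset_span hb)
      · exact Ideal.mem_map_of_mem _ (Ideal.subset_span (Finset.mem_erase.mpr ⟨hag, ha⟩))
    · rw [Ideal.span_le]
      exact fun a ha => hsm a (Finset.mem_of_mem_erase ha)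
  rw [hmap]
  refine (Submodule.spanFinrank_span_le_ncard_of_finite
    ((s.erase g).finite_toSet.image _)).trans_lt ?_
  refine (Set.ncard_image_le (s.erase g).finite_toSet).trans_lt ?_
  rw [Set.ncard_coe_finset, ← hcard]
  exact Finset.card_erase_lt_of_mem hg

/-- A Noetherian local ring with a prime principal ideal `(x)`, where `x` avoids all minimal
primes, is a domain: a minimal prime `𝔭 ⊆ (x)` satisfies `𝔭 = x𝔭`, hence vanishes by Nakayama. -/
lemma IsLocalRing.isDomain_of_isPrime_span_singleton {R : Type*} [CommRing R] [IsLocalRing R]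
    [IsNoetherianRing R] {x : R} (hx : x ∈ maximalIdeal R)
    (hmin : ∀ p ∈ minimalPrimes R, x ∉ p) (hprime : (Ideal.span {x}).IsPrime) : IsDomain R := by
  obtain ⟨p, hp, hpx⟩ := Ideal.exists_minimalPrimes_le (I := (⊥ : Ideal R))
    (J := Ideal.span {x}) bot_le
  have hpp : p.IsPrime := hp.1.1
  have hbot : p = ⊥ := by
    refine Submodule.eq_bot_of_le_smul_of_le_jacobson_bot (Ideal.span {x}) p
      p.fg_of_isNoetherianRing ?_
      (((Ideal.span_singleton_le_iff_mem _).mpr hx).trans (maximalIdeal_le_jacobson _))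
    intro y hy
    obtain ⟨a, rfl⟩ := Ideal.mem_span_singleton'.mp (hpx hy)
    have ha : a ∈ p := (hpp.mem_or_mem hy).resolve_right (hmin p hp)
    rw [mul_comm, ← smul_eq_mul]
    exact Submodule.smul_mem_smul (Ideal.mem_span_singleton_self x) ha
  subst hbot
  exact IsDomain.of_bot_isPrime R

/-- Prime avoidance: in positive dimension there is `x ∈ 𝔪 ∖ 𝔪²` outside all minimal primes. -/
lemma IsLocalRing.exists_mem_maximalIdeal_notMem {R : Type*} [CommRing R] [IsLocalRing R]
    [IsNoetherianRing R] (hdim : 0 < ringKrullDim R) :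
    ∃ x ∈ maximalIdeal R, x ∉ maximalIdeal R ^ 2 ∧ ∀ p ∈ minimalPrimes R, x ∉ p := by
  by_contra! h
  have hsub : ((maximalIdeal R : Ideal R) : Set R) ⊆
      ⋃ i ∈ insert (maximalIdeal R ^ 2) (minimalPrimes R), (i : Set R) := by
    intro x hx
    by_cases hx2 : x ∈ maximalIdeal R ^ 2
    · exact Set.mem_biUnion (Set.mem_insert _ _) hx2
    · obtain ⟨p, hp, hxp⟩ := h x hx hx2
      exact Set.mem_biUnion (Set.mem_insert_of_mem _ hp) hxp
  rw [Ideal.subset_union_prime_finite (f := fun i => i)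
    ((minimalPrimes.finite_of_isNoetherianRing R).insert _)
    (maximalIdeal R ^ 2) (maximalIdeal R ^ 2)
    (fun i hi h1 _ => ((Set.mem_insert_iff.mp hi).resolve_left h1).1.1)] at hsub
  obtain ⟨i, hi, hle⟩ := hsub
  have hne : maximalIdeal R ∉ minimalPrimes R := by
    intro hm
    rw [← maximalIdeal_height_eq_ringKrullDim] at hdim
    have : (maximalIdeal R).height = 0 := by
      rw [Ideal.height_eq_zero_iff]
      exact hm
    simp [this] at hdim
  rcases Set.mem_insert_iff.mp hi with rfl | hi
  · have hbot : maximalIdeal R = ⊥ := by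
      refine Submodule.eq_bot_of_le_smul_of_le_jacobson_bot (maximalIdeal R) _
        (maximalIdeal R).fg_of_isNoetherianRing ?_ (maximalIdeal_le_jacobson _)
      rwa [pow_two] at hle
    refine hne ⟨⟨inferInstance, bot_le⟩, fun q _ _ => ?_⟩
    rw [hbot]
    exact bot_le
  · have hip : i.IsPrime := hi.1.1
    have : i = maximalIdeal R := le_antisymm (le_maximalIdeal hip.ne_top) hle
    exact hne (this ▸ hi)

/-- Dividing a regular local ring by an element of `𝔪 ∖ 𝔪²` gives a regular local ring of dimension
one less: the embedding dimension drops, and the dimension drops by at most one. -/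
lemma IsRegularLocalRing.quotient_span_singleton {R : Type*} [CommRing R] [IsRegularLocalRing R]
    {x : R} (hx : x ∈ maximalIdeal R) (hx2 : x ∉ maximalIdeal R ^ 2) {n : ℕ}
    (hn : ringKrullDim R = (n + 1 : ℕ)) :
    IsRegularLocalRing (R ⧸ Ideal.span {x}) ∧ ringKrullDim (R ⧸ Ideal.span {x}) = n := by
  have hne : Ideal.span {x} ≠ ⊤ := fun h =>
    (mem_maximalIdeal x).mp hx (Ideal.span_singleton_eq_top.mp h)
  have : Nontrivial (R ⧸ Ideal.span {x}) := Ideal.Quotient.nontrivial_iff.mpr hne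
  have : IsLocalRing (R ⧸ Ideal.span {x}) :=
    .of_surjective' (Ideal.Quotient.mk (Ideal.span {x})) Ideal.Quotient.mk_surjective
  have h1 := IsLocalRing.spanFinrank_maximalIdeal_quotient_lt hx hx2
  have h2 : ((maximalIdeal R).spanFinrank : WithBot ℕ∞) = (n + 1 : ℕ) :=
    (IsRegularLocalRing.spanFinrank_maximalIdeal (R := R)).trans hn
  have h2' : (maximalIdeal R).spanFinrank = n + 1 := by exact_mod_cast h2
  have h3 : ringKrullDim R ≤ ringKrullDim (R ⧸ Ideal.span {x}) + 1 := by
    have := ringKrullDim_le_ringKrullDim_quotient_add_card ({x} : Finset R) (by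
      simpa [IsLocalRing.ringJacobson_eq_maximalIdeal] using hx)
    rwa [Finset.coe_singleton, Finset.card_singleton, Nat.cast_one] at this
  have h4 := ringKrullDim_le_spanFinrank_maximalIdeal (R ⧸ Ideal.span {x})
  have h5 : (n : WithBot ℕ∞) ≤ ringKrullDim (R ⧸ Ideal.span {x}) := by
    rw [hn, Nat.cast_add, Nat.cast_one, ENat.WithBot.add_le_add_one_right_iff] at h3
    exact h3
  have h6 : ((maximalIdeal (R ⧸ Ideal.span {x})).spanFinrank : WithBot ℕ∞) ≤ n := by
    exact_mod_cast (by lia : (maximalIdeal (R ⧸ Ideal.span {x})).spanFinrank ≤ n)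
  exact ⟨.of_spanFinrank_maximalIdeal_le _ (h6.trans h5), le_antisymm (h4.trans h6) h5⟩

/-- Regular local rings are domains, by induction on the dimension: dividing by a regular parameter
that avoids the minimal primes leaves a domain. -/
lemma IsRegularLocalRing.isDomain_of_ringKrullDim_eq (n : ℕ) : ∀ (R : Type*) [CommRing R]
    [IsRegularLocalRing R], ringKrullDim R = n → IsDomain R := by
  induction n with
  | zero =>
    intro R _ _ hR
    have h : ((maximalIdeal R).spanFinrank : WithBot ℕ∞) = (0 : ℕ) :=
      (IsRegularLocalRing.spanFinrank_maximalIdeal (R := R)).trans hR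
    have h' : (maximalIdeal R).spanFinrank = 0 := by exact_mod_cast h
    rw [Submodule.spanFinrank_eq_zero_iff_eq_bot (maximalIdeal R).fg_of_isNoetherianRing] at h'
    have : (⊥ : Ideal R).IsPrime := h' ▸ inferInstance
    exact IsDomain.of_bot_isPrime R
  | succ n ih =>
    intro R _ _ hR
    obtain ⟨x, hx, hx2, hmin⟩ := IsLocalRing.exists_mem_maximalIdeal_notMem (R := R)
      (by rw [hR]; exact_mod_cast n.succ_pos)
    obtain ⟨hreg, hdim⟩ := IsRegularLocalRing.quotient_span_singleton hx hx2 hR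
    have := ih _ hdim
    exact isDomain_of_isPrime_span_singleton hx hmin
      ((Ideal.Quotient.isDomain_iff_prime _).mp this)

/-- For a nonzerodivisor `x`, a finitely generated free `R ⧸ (x)`-module has projective dimension at
most one over `R`, so restriction of scalars raises projective dimensions by at most one. -/
lemma ModuleCat.hasProjectiveDimensionLE_restrictScalars_quotient {R : Type u} [CommRing R]
    [IsLocalRing R] [IsNoetherianRing R] {x : R} (hx : x ∈ nonZeroDivisors R)
    (hxm : x ∈ maximalIdeal R) (n : ℕ) (N : ModuleCat.{u} (R ⧸ Ideal.span {x}))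
    [Module.Finite (R ⧸ Ideal.span {x}) N] [HasProjectiveDimensionLE N n] :
    HasProjectiveDimensionLE
      ((ModuleCat.restrictScalars (Ideal.Quotient.mk (Ideal.span {x}))).obj N) (n + 1) := by
  have hne : Ideal.span {x} ≠ ⊤ := fun h =>
    (mem_maximalIdeal x).mp hxm (Ideal.span_singleton_eq_top.mp h)
  have : Nontrivial (R ⧸ Ideal.span {x}) := Ideal.Quotient.nontrivial_iff.mpr hne
  have : IsLocalRing (R ⧸ Ideal.span {x}) :=
    .of_surjective' (Ideal.Quotient.mk (Ideal.span {x})) Ideal.Quotient.mk_surjective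
  induction n generalizing N with
  | zero =>
    have hN : Module.Projective (R ⧸ Ideal.span {x}) N := by
      rw [IsProjective.iff_projective]
      exact (projective_iff_hasProjectiveDimensionLE_zero _).mpr inferInstance
    have : Module.Free (R ⧸ Ideal.span {x}) N := Module.free_of_flat_of_isLocalRing
    let ι := Module.Free.ChooseBasisIndex (R ⧸ Ideal.span {x}) N
    let b := Module.Free.chooseBasis (R ⧸ Ideal.span {x}) N
    let q : (ι →₀ R) →ₗ[R] (ι →₀ (R ⧸ Ideal.span {x})) :=
      Finsupp.mapRange.linearMap (Submodule.mkQ (Ideal.span {x}))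
    let g : ModuleCat.of R (ι →₀ R) ⟶ ModuleCat.of R (ι →₀ (R ⧸ Ideal.span {x})) :=
      ModuleCat.ofHom q
    let f : ModuleCat.of R (ι →₀ R) ⟶ ModuleCat.of R (ι →₀ R) :=
      ModuleCat.ofHom (LinearMap.lsmul R (ι →₀ R) x)
    have hqx : ∀ v, q (x • v) = 0 := fun v => by
      ext i
      change Ideal.Quotient.mk (Ideal.span {x}) (x * v i) = 0
      exact Ideal.Quotient.eq_zero_iff_mem.mpr
        (Ideal.mul_mem_right _ _ (Ideal.mem_span_singleton_self x))
    have hS : (ShortComplex.mk f g (ModuleCat.hom_ext (LinearMap.ext hqx))).ShortExact :=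
      { exact := by
          classical
          rw [ShortComplex.moduleCat_exact_iff]
          intro v hv
          have hd : ∀ i, ∃ r, r * x = (v : ι →₀ R) i := fun i => by
            rw [← Ideal.mem_span_singleton']
            exact Ideal.Quotient.eq_zero_iff_mem.mp (DFunLike.congr_fun hv i)
          choose r hr using hd
          refine ⟨Finsupp.onFinset (v : ι →₀ R).support
            (fun i => if (v : ι →₀ R) i = 0 then 0 else r i) fun i hi => by
            rw [Finsupp.mem_support_iff]; exact fun h => hi (if_pos h), ?_⟩
          refine Finsupp.ext fun i => ?_
          change x * (if (v : ι →₀ R) i = 0 then 0 else r i) = (v : ι →₀ R) i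
          split_ifs with h
          · rw [mul_zero, h]
          · rw [mul_comm, hr]
        mono_f := by
          rw [ModuleCat.mono_iff_injective]
          intro v w hvw
          refine Finsupp.ext fun i => ?_
          refine sub_eq_zero.mp (mem_nonZeroDivisors_iff_left.mp hx _ ?_)
          rw [mul_sub, sub_eq_zero]
          exact DFunLike.congr_fun hvw i
        epi_g := by
          rw [ModuleCat.epi_iff_surjective]
          exact Finsupp.mapRange_surjective _ rfl (Submodule.mkQ_surjective (Ideal.span {x})) }
    have hP : Projective (ModuleCat.of R (ι →₀ R)) :=
      ModuleCat.projective_of_free Finsupp.basisSingleOne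
    have h2 : HasProjectiveDimensionLE (ModuleCat.of R (ι →₀ (R ⧸ Ideal.span {x}))) 1 :=
      (hS.hasProjectiveDimensionLT_X₃_iff 0 hP).mpr
        (projective_iff_hasProjectiveDimensionLT_one.mp hP)
    let e : (ι →₀ (R ⧸ Ideal.span {x})) ≃ₗ[R]
        ((ModuleCat.restrictScalars (Ideal.Quotient.mk (Ideal.span {x}))).obj N) :=
      { b.repr.symm.toAddEquiv with
        map_smul' := fun r v => by
          rw [← algebraMap_smul (R ⧸ Ideal.span {x}) r v]
          exact b.repr.symm.map_smul _ v }
    exact hasProjectiveDimensionLT_of_iso e.toModuleIso 2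
  | succ n ih =>
    obtain ⟨P, _, _, _, _, f, hf⟩ := Module.exists_finite_presentation (R ⧸ Ideal.span {x}) N
    have hS := LinearMap.shortExact_shortComplexKer hf
    have hP : Projective f.shortComplexKer.X₂ :=
      ModuleCat.projective_of_free (Module.Free.chooseBasis (R ⧸ Ideal.span {x}) P)
    have h1 : HasProjectiveDimensionLE f.shortComplexKer.X₁ n :=
      (hS.hasProjectiveDimensionLT_X₃_iff n hP).mp ‹_›
    have : Module.Finite (R ⧸ Ideal.span {x}) f.shortComplexKer.X₁ :=
      inferInstanceAs (Module.Finite _ (LinearMap.ker f))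
    have : Module.Finite (R ⧸ Ideal.span {x}) f.shortComplexKer.X₂ :=
      inferInstanceAs (Module.Finite _ P)
    have : HasProjectiveDimensionLE f.shortComplexKer.X₂ n :=
      have := projective_iff_hasProjectiveDimensionLT_one.mp hP
      hasProjectiveDimensionLT_of_ge _ 1 (n + 1) (by lia)
    have h2 : HasProjectiveDimensionLT (f.shortComplexKer.map
        (ModuleCat.restrictScalars (Ideal.Quotient.mk (Ideal.span {x})))).X₂ (n + 2) :=
      ih f.shortComplexKer.X₂
    exact (hS.map_of_exact (ModuleCat.restrictScalars (Ideal.Quotient.mk (Ideal.span {x})))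
      ).hasProjectiveDimensionLT_X₃ (n + 2) (ih f.shortComplexKer.X₁)
      (hasProjectiveDimensionLT_of_ge _ (n + 2) (n + 3) (by lia))

/-- Finitely generated modules over a regular local ring have finite projective dimension. Modulo a
regular parameter `x` the dimension drops, and the first syzygy `Z` of a module is `x`-torsion-free,
so the projective dimension of `Z` is controlled by that of `Z ⧸ xZ`. -/
lemma IsRegularLocalRing.exists_hasProjectiveDimensionLE (n : ℕ) : ∀ (R : Type u) [CommRing R]
    [IsRegularLocalRing R] (_ : ringKrullDim R = n) (M : ModuleCat.{u} R) [Module.Finite R M],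
    ∃ d, HasProjectiveDimensionLE M d := by
  induction n with
  | zero =>
    intro R _ _ hR M _
    have h : ((maximalIdeal R).spanFinrank : WithBot ℕ∞) = (0 : ℕ) :=
      (IsRegularLocalRing.spanFinrank_maximalIdeal (R := R)).trans hR
    have h' : (maximalIdeal R).spanFinrank = 0 := by exact_mod_cast h
    rw [Submodule.spanFinrank_eq_zero_iff_eq_bot (maximalIdeal R).fg_of_isNoetherianRing] at h'
    let := (IsLocalRing.isField_iff_maximalIdeal_eq.mpr h').toField
    have hM : Module.Projective R M := by
      let : IsSemisimpleRing R := inferInstance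
      exact Module.projective_of_isSemisimpleRing R M
    exact ⟨0, (projective_iff_hasProjectiveDimensionLE_zero _).mp
      ((IsProjective.iff_projective M).mp hM)⟩
  | succ n ih =>
    intro R _ _ hR M _
    have := isDomain_of_ringKrullDim_eq (n + 1) R hR
    obtain ⟨x, hx, hx2, hmin⟩ := IsLocalRing.exists_mem_maximalIdeal_notMem (R := R)
      (by rw [hR]; exact_mod_cast n.succ_pos)
    obtain ⟨hreg, hdim⟩ := IsRegularLocalRing.quotient_span_singleton hx hx2 hR
    have hx0 : x ≠ 0 := fun h => hx2 (h ▸ zero_mem _)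
    obtain ⟨P, _, _, _, _, f, hf⟩ := Module.exists_finite_presentation R M
    have hS := LinearMap.shortExact_shortComplexKer hf
    have hP : Projective f.shortComplexKer.X₂ :=
      ModuleCat.projective_of_free (Module.Free.chooseBasis R P)
    have hxP : IsSMulRegular P x := isSMulRegular_iff_right_eq_zero_of_smul.mpr
      fun y hy => (smul_eq_zero.mp hy).resolve_left hx0
    have hxZ : IsSMulRegular (LinearMap.ker f) x :=
      hxP.of_injective (LinearMap.ker f).subtype (LinearMap.ker f).injective_subtype
    have : Module.Finite (R ⧸ Ideal.span {x}) (QuotSMulTop x (LinearMap.ker f)) :=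
      Module.Finite.of_restrictScalars_finite R _ _
    obtain ⟨d, hd⟩ := ih (R ⧸ Ideal.span {x}) hdim
      (ModuleCat.of (R ⧸ Ideal.span {x}) (QuotSMulTop x (LinearMap.ker f)))
    have hd' := ModuleCat.hasProjectiveDimensionLE_restrictScalars_quotient
      (mem_nonZeroDivisors_of_ne_zero hx0) hx d
      (ModuleCat.of (R ⧸ Ideal.span {x}) (QuotSMulTop x (LinearMap.ker f)))
    have e : (ModuleCat.restrictScalars (Ideal.Quotient.mk (Ideal.span {x}))).obj
        (ModuleCat.of (R ⧸ Ideal.span {x}) (QuotSMulTop x (LinearMap.ker f))) ≅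
        ModuleCat.of R (QuotSMulTop x (LinearMap.ker f)) :=
      LinearEquiv.toModuleIso
        { toFun := fun m => m
          invFun := fun m => m
          left_inv := fun _ => rfl
          right_inv := fun _ => rfl
          map_add' := fun _ _ => rfl
          map_smul' := fun r m => algebraMap_smul (R ⧸ Ideal.span {x}) r
            (m : QuotSMulTop x (LinearMap.ker f)) }
    have h1 := hasProjectiveDimensionLT_of_iso e (d + 2)
    have h2 := ModuleCat.projectiveDimension_quotSMulTop_eq_succ_of_isSMulRegular
      (ModuleCat.of R (LinearMap.ker f)) x hxZ hx
    have h3 := (projectiveDimension_le_iff (ModuleCat.of R (QuotSMulTop x (LinearMap.ker f)))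
      (d + 1)).mpr h1
    have h4 : HasProjectiveDimensionLE (ModuleCat.of R (LinearMap.ker f)) d := by
      rw [← projectiveDimension_le_iff]
      erw [h2] at h3
      rwa [Nat.cast_add, Nat.cast_one, ENat.WithBot.add_le_add_one_right_iff] at h3
    exact ⟨d + 1, (hS.hasProjectiveDimensionLT_X₃_iff d hP).mpr h4⟩

/-- The locus where a finitely generated module has projective dimension at most `n` is open: it is
the free locus of a syzygy. -/
lemma ModuleCat.isOpen_hasProjectiveDimensionLE {R : Type u} [CommRing R] [IsNoetherianRing R]
    (n : ℕ) (M : ModuleCat.{u} R) [Module.Finite R M] :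
    IsOpen {p : PrimeSpectrum R |
      HasProjectiveDimensionLE (M.localizedModule p.asIdeal.primeCompl) n} := by
  induction n generalizing M with
  | zero =>
    have : Module.FinitePresentation R M := Module.finitePresentation_of_finite R M
    convert Module.isOpen_freeLocus (R := R) (M := M) using 1
    ext p
    rw [Set.mem_ofPred_eq, Module.mem_freeLocus_of_isLocalization p (Localization.AtPrime p.asIdeal)
      (M.localizedModule p.asIdeal.primeCompl) (M.localizedModuleMkLinearMap _),
      ← projective_iff_hasProjectiveDimensionLE_zero, ← IsProjective.iff_projective]
    have : Module.Finite (Localization.AtPrime p.asIdeal)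
        (M.localizedModule p.asIdeal.primeCompl) :=
      Module.Finite.of_isLocalizedModule p.asIdeal.primeCompl
        (M.localizedModuleMkLinearMap p.asIdeal.primeCompl)
    exact ⟨fun h => Module.free_of_flat_of_isLocalRing, fun h => Module.Projective.of_free⟩
  | succ n ih =>
    obtain ⟨P, _, _, _, _, f, hf⟩ := Module.exists_finite_presentation R M
    have hS := LinearMap.shortExact_shortComplexKer hf
    have hP : Projective f.shortComplexKer.X₂ :=
      ModuleCat.projective_of_free (Module.Free.chooseBasis R P)
    have : Module.Finite R f.shortComplexKer.X₁ :=
      inferInstanceAs (Module.Finite _ (LinearMap.ker f))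
    convert ih f.shortComplexKer.X₁ using 1
    ext p
    exact (hS.map_of_exact (ModuleCat.localizedModuleFunctor p.asIdeal.primeCompl)
      ).hasProjectiveDimensionLT_X₃_iff n
        ((ModuleCat.localizedModuleFunctor.{u}
          p.asIdeal.primeCompl).projective_obj_of_projective hP)

/-- Finitely generated modules over a regular ring have finite projective dimension, even if the
ring has infinite Krull dimension: finiteness at each prime spreads out to a neighbourhood, and the
spectrum is quasi-compact. -/
lemma IsRegularRing.exists_hasProjectiveDimensionLE {R : Type u} [CommRing R] [IsRegularRing R]
    (M : ModuleCat.{u} R) [Module.Finite R M] : ∃ d, HasProjectiveDimensionLE M d := by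
  let U : ℕ → Set (PrimeSpectrum R) := fun n =>
    {p | HasProjectiveDimensionLE (M.localizedModule p.asIdeal.primeCompl) n}
  have hmono : Monotone U := fun a b hab p (hp : HasProjectiveDimensionLE _ a) =>
    hasProjectiveDimensionLT_of_ge _ (a + 1) (b + 1) (by lia)
  have hcover : (Set.univ : Set (PrimeSpectrum R)) ⊆ ⋃ n, U n := by
    intro p _
    have : Module.Finite (Localization.AtPrime p.asIdeal)
        (M.localizedModule p.asIdeal.primeCompl) :=
      Module.Finite.of_isLocalizedModule p.asIdeal.primeCompl
        (M.localizedModuleMkLinearMap p.asIdeal.primeCompl)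
    obtain ⟨d, hd⟩ := IsRegularLocalRing.exists_hasProjectiveDimensionLE
      (maximalIdeal (Localization.AtPrime p.asIdeal)).spanFinrank
      (Localization.AtPrime p.asIdeal) IsRegularLocalRing.spanFinrank_maximalIdeal.symm
      (M.localizedModule p.asIdeal.primeCompl)
    exact Set.mem_iUnion.mpr ⟨d, hd⟩
  obtain ⟨n, hn⟩ := isCompact_univ.elim_directed_cover U
    (fun n => ModuleCat.isOpen_hasProjectiveDimensionLE n M) hcover hmono.directed_le
  exact ⟨n, (M.hasProjectiveDimensionLE_iff_forall_primeSpectrum n).mpr fun p => hn trivial⟩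

end RegularRing

/-! ### Grothendieck groups of triangulated subcategories and classes of modules -/

noncomputable section Grothendieck

namespace TriangulatedKTheory

open scoped ZeroObject

variable {C : Type u} [Category.{v} C] [HasZeroObject C] [HasShift C ℤ] [Preadditive C]
  [∀ n : ℤ, (shiftFunctor C n).Additive] [Pretriangulated C] {P : ObjectProperty C}

lemma K₀.mk_eq_add {X Y Z : C} (hX : P X) (hY : P Y) (hZ : P Z) {f : X ⟶ Y} {g : Y ⟶ Z}
    {h : Z ⟶ X⟦(1 : ℤ)⟧} (hT : Triangle.mk f g h ∈ distTriang C) :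
    K₀.mk Y hY = K₀.mk X hX + K₀.mk Z hZ := by
  rw [← sub_eq_zero, ← sub_sub]
  exact (QuotientAddGroup.eq_zero_iff _).mpr
    (AddSubgroup.subset_closure ⟨⟨X, hX⟩, ⟨Y, hY⟩, ⟨Z, hZ⟩, f, g, h, hT, rfl⟩)

lemma K₀.induction_on {motive : K₀ P → Prop} (x : K₀ P) (mk : ∀ X hX, motive (K₀.mk X hX))
    (zero : motive 0) (neg : ∀ x, motive x → motive (-x))
    (add : ∀ x y, motive x → motive y → motive (x + y)) : motive x := by
  obtain ⟨x, rfl⟩ := QuotientAddGroup.mk_surjective x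
  induction x using FreeAbelianGroup.induction_on with
  | zero => exact zero
  | of X => exact mk X.obj X.property
  | neg X h => exact neg _ (mk X.obj X.property)
  | add x y hx hy => exact add _ _ hx hy

/-- The objects of the subcategory `P` whose class lies in a given subgroup of the Grothendieck
group of `P`. -/
def classIn (S : AddSubgroup (K₀ P)) : ObjectProperty C := fun X => ∃ hX : P X, K₀.mk X hX ∈ S

lemma K₀.mk_eq_zero {X : C} (hX : IsZero X) (hPX : P X) : K₀.mk X hPX = 0 := by
  have hT : Triangle.mk (𝟙 X) (𝟙 X) (0 : X ⟶ X⟦(1 : ℤ)⟧) ∈ distTriang C :=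
    isomorphic_distinguished _ (contractible_distinguished X) _
      (Triangle.isoMk _ _ (Iso.refl _) (Iso.refl _) (hX.iso (isZero_zero C))
        (hX.eq_of_src _ _) (hX.eq_of_src _ _) (hX.eq_of_src _ _))
  simpa using K₀.mk_eq_add hPX hPX hPX hT

variable [P.IsTriangulated]

lemma K₀.mk_eq_of_iso [P.IsClosedUnderIsomorphisms] {X Y : C} (e : X ≅ Y) (hX : P X) (hY : P Y) :
    K₀.mk X hX = K₀.mk Y hY := by
  have hT : Triangle.mk e.hom (0 : Y ⟶ 0) (0 : 0 ⟶ X⟦(1 : ℤ)⟧) ∈ distTriang C :=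
    isomorphic_distinguished _ (contractible_distinguished X) _
      (Triangle.isoMk _ _ (Iso.refl _) e.symm (Iso.refl _)
        (e.hom_inv_id.trans (Category.id_comp _).symm) ((isZero_zero C).eq_of_tgt _ _)
        ((isZero_zero C).eq_of_src _ _))
  have h0 : P (0 : C) := P.prop_zero
  have := K₀.mk_eq_add hX hY h0 hT
  rw [this, K₀.mk_eq_zero (isZero_zero C), add_zero]

lemma K₀.mk_shift [P.IsClosedUnderIsomorphisms] {X : C} (hX : P X) (hX1 : P (X⟦(1 : ℤ)⟧)) :
    K₀.mk (X⟦(1 : ℤ)⟧) hX1 = -K₀.mk X hX := by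
  have h0 : P (0 : C) := P.prop_zero
  have := K₀.mk_eq_add hX h0 hX1 (contractible_distinguished₂ X)
  rw [K₀.mk_eq_zero (isZero_zero C)] at this
  exact eq_neg_of_add_eq_zero_right this.symm

variable [P.IsClosedUnderIsomorphisms] (S : AddSubgroup (K₀ P))

lemma classIn_of_iso {X Y : C} (e : X ≅ Y) (hX : classIn S X) : classIn S Y := by
  obtain ⟨hX, hXS⟩ := hX
  have hY : P Y := P.prop_of_iso e hX
  exact ⟨hY, K₀.mk_eq_of_iso e hX hY ▸ hXS⟩

lemma classIn_ext₂ {T : Triangle C} (hT : T ∈ distTriang C) (h₁ : classIn S T.obj₁)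
    (h₃ : classIn S T.obj₃) : classIn S T.obj₂ := by
  obtain ⟨h₁, h₁S⟩ := h₁
  obtain ⟨h₃, h₃S⟩ := h₃
  have h₂ := P.ext_of_isTriangulatedClosed₂ T hT h₁ h₃
  exact ⟨h₂, (K₀.mk_eq_add h₁ h₂ h₃ hT) ▸ S.add_mem h₁S h₃S⟩

lemma classIn_ext₃ {T : Triangle C} (hT : T ∈ distTriang C) (h₁ : classIn S T.obj₁)
    (h₂ : classIn S T.obj₂) : classIn S T.obj₃ := by
  obtain ⟨h₁, h₁S⟩ := h₁
  obtain ⟨h₂, h₂S⟩ := h₂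
  have h₃ := P.ext_of_isTriangulatedClosed₃ T hT h₁ h₂
  have := K₀.mk_eq_add h₁ h₂ h₃ hT
  exact ⟨h₃, (S.add_mem_cancel_left h₁S).mp (this ▸ h₂S)⟩

lemma classIn_shift_one {X : C} (hX : classIn S X) : classIn S (X⟦(1 : ℤ)⟧) := by
  obtain ⟨hX, hXS⟩ := hX
  have hX1 : P (X⟦(1 : ℤ)⟧) := P.le_shift 1 _ hX
  exact ⟨hX1, K₀.mk_shift hX hX1 ▸ S.neg_mem hXS⟩

lemma classIn_of_shift_one {X : C} (hX : classIn S (X⟦(1 : ℤ)⟧)) : classIn S X := by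
  obtain ⟨hX1, hXS⟩ := hX
  have hX : P X := P.prop_of_iso ((shiftEquiv C (1 : ℤ)).unitIso.app X).symm (P.le_shift (-1) _ hX1)
  exact ⟨hX, S.neg_mem_iff.mp (K₀.mk_shift hX hX1 ▸ hXS)⟩

end TriangulatedKTheory

open TriangulatedKTheory

variable {R : Type u} [CommRing R] [IsNoetherianRing R]

lemma FGModuleCat.shortExact_of_exact {M N P : Type u} [AddCommGroup M] [Module R M]
    [Module.Finite R M] [AddCommGroup N] [Module R N] [Module.Finite R N] [AddCommGroup P]
    [Module R P] [Module.Finite R P] (f : M →ₗ[R] N) (g : N →ₗ[R] P)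
    (hf : Function.Injective f) (hfg : Function.Exact f g) (hg : Function.Surjective g) :
    (ShortComplex.mk (FGModuleCat.ofHom f) (FGModuleCat.ofHom g)
      (FGModuleCat.hom_ext hfg.linearMap_comp_eq_zero)).ShortExact := by
  have h : ((ShortComplex.mk (FGModuleCat.ofHom f) (FGModuleCat.ofHom g)
      (FGModuleCat.hom_ext hfg.linearMap_comp_eq_zero)).map
      (forget₂ (FGModuleCat.{u} R) (ModuleCat.{u} R))).ShortExact :=
    { exact := (ShortComplex.ShortExact.moduleCat_exact_iff_function_exact _).mpr hfg
      mono_f := (ModuleCat.mono_iff_injective _).mpr hf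
      epi_g := (ModuleCat.epi_iff_surjective _).mpr hg }
  exact
    { exact := (ShortComplex.exact_map_iff_of_faithful _ _).mp h.exact
      mono_f := (forget₂ (FGModuleCat.{u} R) (ModuleCat.{u} R)).mono_of_mono_map h.mono_f
      epi_g := (forget₂ (FGModuleCat.{u} R) (ModuleCat.{u} R)).epi_of_epi_map h.epi_g }

variable (R) [HasDerivedCategory.{w} (FGModuleCat.{u} R)]

instance : (boundedObjects.{w} R).IsTriangulated :=
  inferInstanceAs DerivedCategory.TStructure.t.bounded.IsTriangulated

instance : (boundedObjects.{w} R).IsClosedUnderIsomorphisms :=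
  inferInstanceAs DerivedCategory.TStructure.t.bounded.IsClosedUnderIsomorphisms

variable {R}

lemma boundedObjects_singleFunctor (M : FGModuleCat.{u} R) (n : ℤ) :
    boundedObjects.{w} R ((DerivedCategory.singleFunctor _ n).obj M) :=
  ⟨⟨n, inferInstanceAs (DerivedCategory.IsGE _ n)⟩, ⟨n, inferInstanceAs (DerivedCategory.IsLE _ n)⟩⟩

/-- The class in `K₀'(R)` of a finitely generated module, placed in degree `0`. -/
def moduleClass (M : FGModuleCat.{u} R) : RingK₀'.{w} R :=
  K₀.mk ((DerivedCategory.singleFunctor _ 0).obj M) (boundedObjects_singleFunctor M 0)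

/-- Membership of a class in a subgroup does not depend on the degree in which a module is put. -/
lemma classIn_singleFunctor (S : AddSubgroup (RingK₀'.{w} R)) {M : FGModuleCat.{u} R}
    (hM : moduleClass M ∈ S) (n : ℤ) : classIn S ((DerivedCategory.singleFunctor _ n).obj M) := by
  induction n using Int.induction_on with
  | zero => exact ⟨_, hM⟩
  | succ n ih =>
    exact classIn_of_shift_one S (classIn_of_iso S
      (((DerivedCategory.singleFunctors (FGModuleCat.{u} R)).shiftIso 1 n (n + 1)
        (add_comm _ _)).app M).symm ih)
  | pred n ih =>
    exact classIn_of_iso S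
      (((DerivedCategory.singleFunctors (FGModuleCat.{u} R)).shiftIso 1 (-n - 1) (-n)
        (by lia)).app M) (classIn_shift_one S ih)

/-- `K₀'(R)` is generated by the classes of modules: a bounded complex is an iterated extension of
shifts of its cohomology modules. -/
lemma eq_top_of_moduleClass_mem (S : AddSubgroup (RingK₀'.{w} R))
    (hS : ∀ M : FGModuleCat.{u} R, moduleClass M ∈ S) : S = ⊤ := by
  have key : ∀ (n : ℕ) (a : ℤ) (X : DerivedCategory (FGModuleCat.{u} R)),
      X.IsGE a → X.IsLE (a + n) → classIn S X := by
    intro n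
    induction n with
    | zero =>
      intro a X h1 h2
      have : X.IsLE a := by simpa using h2
      obtain ⟨M, ⟨e⟩⟩ := X.exists_iso_singleFunctor_obj_of_isGE_of_isLE a
      exact classIn_of_iso S e.symm (classIn_singleFunctor S (hS M) a)
    | succ n ih =>
      intro a X h1 h2
      let t : Triangulated.TStructure (DerivedCategory (FGModuleCat.{u} R)) :=
        DerivedCategory.TStructure.t
      have hn : a + ↑(n + 1) = a + 1 + n := by push_cast; ring
      have h3 : t.IsLE ((t.truncLT (a + 1)).obj X) a := inferInstance
      have h4 : t.IsGE ((t.truncLT (a + 1)).obj X) a := inferInstance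
      have h5 : t.IsLE ((t.truncGE (a + 1)).obj X) (a + ↑(n + 1)) := inferInstance
      have h6 : t.IsGE ((t.truncGE (a + 1)).obj X) (a + 1) := inferInstance
      exact classIn_ext₂ S (t.triangleLTGE_distinguished (a + 1) X)
        (ih a _ h4 (t.isLE_of_le ((t.truncLT (a + 1)).obj X) a (a + n) (by lia)))
        (ih (a + 1) _ h6 (hn ▸ h5))
  refine top_unique fun x _ => ?_
  induction x using K₀.induction_on with
  | mk X hX =>
    obtain ⟨⟨a, ha⟩, ⟨b, hb⟩⟩ := hX
    obtain ⟨_, h⟩ := key (b - a).toNat a X ha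
      (DerivedCategory.TStructure.t.isLE_of_le X b _ (by lia))
    exact h
  | zero => exact S.zero_mem
  | neg x hx => exact S.neg_mem (hx trivial)
  | add x y hx hy => exact S.add_mem (hx trivial) (hy trivial)

lemma moduleClass_eq_add {S : ShortComplex (FGModuleCat.{u} R)} (hS : S.ShortExact) :
    moduleClass.{w} S.X₂ = moduleClass S.X₁ + moduleClass S.X₃ :=
  K₀.mk_eq_add _ _ _ hS.singleTriangle_distinguished

lemma moduleClass_of_eq_add {M N P : Type u} [AddCommGroup M] [Module R M]
    [Module.Finite R M] [AddCommGroup N] [Module R N] [Module.Finite R N] [AddCommGroup P]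
    [Module R P] [Module.Finite R P] (f : M →ₗ[R] N) (g : N →ₗ[R] P)
    (hf : Function.Injective f) (hfg : Function.Exact f g) (hg : Function.Surjective g) :
    moduleClass.{w} (FGModuleCat.of R N) =
      moduleClass (FGModuleCat.of R M) + moduleClass (FGModuleCat.of R P) :=
  moduleClass_eq_add (FGModuleCat.shortExact_of_exact f g hf hfg hg)

lemma moduleClass_of_linearEquiv {M N : Type u} [AddCommGroup M] [Module R M]
    [Module.Finite R M] [AddCommGroup N] [Module R N] [Module.Finite R N] (e : M ≃ₗ[R] N) :
    moduleClass.{w} (FGModuleCat.of R M) = moduleClass (FGModuleCat.of R N) :=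
  K₀.mk_eq_of_iso ((DerivedCategory.singleFunctor _ 0).mapIso e.toFGModuleCatIso) _ _

end Grothendieck

/-! ### Projective amplitude in derived categories -/

section ProjectiveAmplitude

universe w₁ w₂ v₁ v₂ u₁ u₂

namespace DerivedCategory

variable {C : Type u₁} [Category.{v₁} C] [Abelian C] [HasDerivedCategory.{w₁} C]

/-- `Y` has projective amplitude at least `a` if it is left orthogonal to the objects of
cohomological degrees `< a`. A bounded complex of projectives in degrees `≥ a` has this property,
which, unlike the existence of such a complex, passes directly to the terms of triangles. -/
def ProjAmplitudeGE (Y : DerivedCategory C) (a : ℤ) : Prop :=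
  ∀ (W : DerivedCategory C), W.IsLE (a - 1) → ∀ g : Y ⟶ W, g = 0

lemma ProjAmplitudeGE.of_iso {X Y : DerivedCategory C} {a : ℤ} (hX : ProjAmplitudeGE X a)
    (e : X ≅ Y) : ProjAmplitudeGE Y a := fun W hW g => by
  rw [← cancel_epi e.hom, hX W hW (e.hom ≫ g), comp_zero]

lemma ProjAmplitudeGE.of_le {X : DerivedCategory C} {a b : ℤ} (hX : ProjAmplitudeGE X b)
    (hab : a ≤ b) : ProjAmplitudeGE X a := fun W _ g =>
  hX W (TStructure.t.isLE_of_le W (a - 1) (b - 1) (by lia)) g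

lemma projAmplitudeGE_Q_obj (L : CochainComplex C ℤ) (a b : ℤ) [L.IsStrictlyGE a]
    [L.IsStrictlyLE b] [∀ i, Projective (L.X i)] : ProjAmplitudeGE (Q.obj L) a := by
  intro W hW g
  obtain ⟨K, _, ⟨e⟩⟩ := W.exists_iso_Q_obj_of_isLE (a - 1)
  have := CochainComplex.isKProjective_of_projective L b
  rw [← cancel_mono e.hom, zero_comp]
  obtain ⟨f, hf⟩ := (CochainComplex.IsKProjective.Qh_map_bijective L
    ((HomotopyCategory.quotient _ _).obj K)).surjective
    ((quotientCompQhIso C).hom.app L ≫ (g ≫ e.hom) ≫ (quotientCompQhIso C).inv.app K)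
  obtain ⟨φ, rfl⟩ := (HomotopyCategory.quotient _ _).map_surjective f
  have hφ : φ = 0 := by
    ext i
    by_cases hi : i < a
    · exact (L.isZero_of_isStrictlyGE a i hi).eq_of_src _ _
    · exact (K.isZero_of_isStrictlyLE (a - 1) i (by lia)).eq_of_tgt _ _
  rw [hφ, Functor.map_zero, Functor.map_zero] at hf
  rw [← cancel_epi ((quotientCompQhIso C).hom.app L),
    ← cancel_mono ((quotientCompQhIso C).inv.app K), Category.assoc, ← hf, comp_zero, zero_comp]

/-- Killing the top cohomology of `X` by a projective in degree `b` shortens the projective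
amplitude by one. -/
lemma ProjAmplitudeGE.of_triangle {T : Triangle (DerivedCategory C)}
    (hT : T ∈ distTriang (DerivedCategory C)) {a b : ℤ} (hab : a < b) {P : C} [Projective P]
    (e : T.obj₂ ≅ (singleFunctor C b).obj P) (h₃ : ProjAmplitudeGE T.obj₃ a) :
    ProjAmplitudeGE T.obj₁ (a + 1) := by
  intro W hW g
  have hWa : W.IsLE a := by simpa using hW
  apply (shiftFunctor (DerivedCategory C) (1 : ℤ)).map_injective
  rw [Functor.map_zero]
  have hP : ∀ k : T.obj₂ ⟶ W, k = 0 := fun k => by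
    obtain ⟨K, _, ⟨eK⟩⟩ := W.exists_iso_Q_obj_of_isLE a
    have h := from_singleFunctor_obj_eq_zero_of_projective (P := P) (L := K) (i := b)
      (((singleFunctorIsoCompQ C b).app P).inv ≫ e.inv ≫ k ≫ eK.hom) a hab
    rw [← cancel_epi e.inv, ← cancel_epi (((singleFunctorIsoCompQ C b).app P).inv),
      ← cancel_mono eK.hom]
    simpa only [Category.assoc, comp_zero, zero_comp] using h
  have hW1 : IsLE (W⟦(1 : ℤ)⟧) (a - 1) := TStructure.t.isLE_shift W a 1 (a - 1) (by lia)
  obtain ⟨k, hk⟩ := Triangle.yoneda_exact₃ T.rotate (rot_of_distTriang _ hT) (g⟦1⟧')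
    (h₃ _ hW1 (T.mor₃ ≫ g⟦1⟧'))
  obtain ⟨k', rfl⟩ := (shiftFunctor (DerivedCategory C) (1 : ℤ)).map_surjective k
  rw [hk, show k' = 0 from hP k', Functor.map_zero]
  exact comp_zero

/-- If `X` has projective amplitude concentrated in degree `b`, a map from a projective in degree
`b` that is surjective on cohomology splits. -/
lemma ProjAmplitudeGE.exists_section {T : Triangle (DerivedCategory C)}
    (hT : T ∈ distTriang (DerivedCategory C)) {b : ℤ} (h₁ : T.obj₁.IsLE b)
    (h₃ : ProjAmplitudeGE T.obj₃ b) : ∃ s : T.obj₃ ⟶ T.obj₂, s ≫ T.mor₂ = 𝟙 T.obj₃ := by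
  have hW : IsLE (T.obj₁⟦(1 : ℤ)⟧) (b - 1) := TStructure.t.isLE_shift T.obj₁ b 1 (b - 1) (by lia)
  obtain ⟨s, hs⟩ := Triangle.coyoneda_exact₃ T hT (𝟙 _) (h₃ _ hW (𝟙 _ ≫ T.mor₃))
  exact ⟨s, hs.symm⟩

/-- If every object of `C` is a quotient of one satisfying `E`, then the top cohomology of `X` can
be killed by such an object in degree `b` without creating cohomology above degree `b`. -/
lemma exists_triangle_of_isLE (X : DerivedCategory C) (b : ℤ) [X.IsLE b]
    {E : C → Prop} (hE : ∀ M : C, ∃ (P : C) (p : P ⟶ M), E P ∧ Epi p) :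
    ∃ (P : C) (_ : E P) (Z : DerivedCategory C) (f : Z ⟶ (singleFunctor C b).obj P)
      (g : (singleFunctor C b).obj P ⟶ X) (h : X ⟶ Z⟦(1 : ℤ)⟧),
      Triangle.mk f g h ∈ distTriang (DerivedCategory C) ∧ Z.IsLE b := by
  obtain ⟨K, _, ⟨e⟩⟩ := X.exists_iso_Q_obj_of_isLE b
  obtain ⟨P, p, hP, hp⟩ := hE (K.X b)
  have hd : ∀ k, p ≫ K.d b k = 0 := fun k => by
    by_cases hk : b < k
    · exact (K.isZero_of_isStrictlyLE b k hk).eq_of_tgt _ _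
    · rw [K.shape _ _ (by simp only [ComplexShape.up_Rel]; lia), comp_zero]
  let φ : (CochainComplex.singleFunctor C b).obj P ⟶ K :=
    HomologicalComplex.mkHomFromSingle p (fun k _ => hd k)
  have hφ : Epi (φ.f b) := by
    have : φ.f b = (HomologicalComplex.singleObjXSelf (ComplexShape.up ℤ) b P).hom ≫ p :=
      HomologicalComplex.mkHomFromSingle_f _ _
    rw [this]
    exact epi_comp (HomologicalComplex.singleObjXSelf (ComplexShape.up ℤ) b P).hom p
  let S := (CochainComplex.singleFunctor C b).obj P
  have hS : IsIso (S.iCycles b) := S.isIso_iCycles b (b + 1) (by simp)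
    ((S.isZero_of_isStrictlyLE b (b + 1) (by simp)).eq_of_tgt _ _)
  have hK : IsIso (K.iCycles b) := K.isIso_iCycles b (b + 1) (by simp)
    ((K.isZero_of_isStrictlyLE b (b + 1) (by simp)).eq_of_tgt _ _)
  have hc : Epi (HomologicalComplex.cyclesMap φ b) := by
    have : HomologicalComplex.cyclesMap φ b = S.iCycles b ≫ φ.f b ≫ inv (K.iCycles b) := by
      rw [← cancel_mono (K.iCycles b)]
      simp [S]
    rw [this]
    infer_instance
  have hH : Epi (HomologicalComplex.homologyMap φ b) := by
    have : Epi (S.homologyπ b ≫ HomologicalComplex.homologyMap φ b) := by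
      rw [HomologicalComplex.homologyπ_naturality]
      infer_instance
    exact epi_of_epi (S.homologyπ b) _
  let g : (singleFunctor C b).obj P ⟶ X := (singleFunctorIsoCompQ C b).hom.app P ≫ Q.map φ ≫ e.inv
  have hHg : Epi ((homologyFunctor C b).map g) := by
    have : Epi ((homologyFunctor C b).map (Q.map φ)) :=
      ((MorphismProperty.epimorphisms C).arrow_mk_iso_iff
        (((Functor.mapArrowFunctor _ _).mapIso (homologyFunctorFactors C b)).app
          (Arrow.mk φ))).mpr hH
    simp only [g, Functor.map_comp]
    infer_instance
  obtain ⟨Z, f, h, hT⟩ := distinguished_cocone_triangle₁ g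
  refine ⟨P, hP, Z, f, g, h, hT, ?_⟩
  rw [isLE_iff]
  intro i hi
  have h1 := HomologySequence.exact₁ _ hT (i - 1) i (by lia)
  refine h1.isZero_of_both_zeros ?_ ?_
  · dsimp
    by_cases hib : i - 1 = b
    · rw [← HomologySequence.epi_homologyMap_mor₂_iff _ hT (i - 1) i (by lia)]
      rw [hib]
      exact hHg
    · exact (isZero_of_isLE X b (i - 1) (by lia)).eq_of_src _ _
  · exact (isZero_of_isLE ((singleFunctor C b).obj P) b i hi).eq_of_tgt _ _

variable {D : Type u₂} [Category.{v₂} D] [Abelian D] [HasDerivedCategory.{w₂} D]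
  (F : C ⥤ D) [F.Additive] [PreservesFiniteLimits F] [PreservesFiniteColimits F]

/-- Exact functors commute with cohomology. -/
lemma nonempty_homologyFunctor_mapDerivedCategory_iso (X : DerivedCategory C) (i : ℤ) :
    Nonempty ((homologyFunctor D i).obj (F.mapDerivedCategory.obj X) ≅
      F.obj ((homologyFunctor C i).obj X)) := by
  let K := Q.objPreimage X
  let e : Q.obj K ≅ X := Q.objObjPreimageIso X
  exact ⟨(homologyFunctor D i).mapIso
    (F.mapDerivedCategory.mapIso e.symm ≪≫ F.mapDerivedCategoryFactors.app K) ≪≫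
    (homologyFunctorFactors D i).app _ ≪≫ (K.sc i).mapHomologyIso F ≪≫
    F.mapIso ((homologyFunctorFactors C i).symm.app K ≪≫ (homologyFunctor C i).mapIso e)⟩

lemma isLE_mapDerivedCategory_obj (X : DerivedCategory C) (n : ℤ) [X.IsLE n] :
    (F.mapDerivedCategory.obj X).IsLE n := by
  rw [isLE_iff]
  intro i hi
  obtain ⟨e⟩ := nonempty_homologyFunctor_mapDerivedCategory_iso F X i
  exact (F.map_isZero (isZero_of_isLE X n i hi)).of_iso e

end DerivedCategory

end ProjectiveAmplitude

/-! ### Perfect complexes and projective modules -/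

section Perfect

open TriangulatedKTheory

variable {R : Type u} [CommRing R]

instance [IsNoetherianRing R] (f : R) : PreservesFiniteLimits (restrictToBasicOpen R f) :=
  comp_preservesFiniteLimits (forget₂ (FGModuleCat.{u} R) (ModuleCat.{u} R))
    (ModuleCat.localizedModuleFunctor (Submonoid.powers f))

instance [IsNoetherianRing R] (f : R) : PreservesFiniteColimits (restrictToBasicOpen R f) :=
  comp_preservesFiniteColimits (forget₂ (FGModuleCat.{u} R) (ModuleCat.{u} R))
    (ModuleCat.localizedModuleFunctor (Submonoid.powers f))

/-- The localization map from `M` to its restriction to `D(f)`. -/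
noncomputable def restrictToBasicOpenMk (f : R) (M : FGModuleCat.{u} R) :
    M →ₗ[R] ((ModuleCat.of R M).localizedModule (Submonoid.powers f)) :=
  (ModuleCat.of R M).localizedModuleMkLinearMap (Submonoid.powers f)

instance (f : R) (M : FGModuleCat.{u} R) :
    IsLocalizedModule (Submonoid.powers f) (restrictToBasicOpenMk f M) :=
  ModuleCat.localizedModule_isLocalizedModule (ModuleCat.of R M) (Submonoid.powers f)

lemma projective_restrictToBasicOpen_obj (f : R) (M : FGModuleCat.{u} R)
    [Module.Projective R M] :
    Module.Projective (Localization (Submonoid.powers f)) ((restrictToBasicOpen R f).obj M) := by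
  have : Module.Projective (Localization (Submonoid.powers f))
      ((ModuleCat.of R M).localizedModule (Submonoid.powers f)) :=
    Module.projective_of_isLocalizedModule (Submonoid.powers f) (restrictToBasicOpenMk f M)
  exact this

lemma finite_restrictToBasicOpen_obj (f : R) (M : FGModuleCat.{u} R) :
    Module.Finite (Localization (Submonoid.powers f)) ((restrictToBasicOpen R f).obj M) := by
  have : Module.Finite (Localization (Submonoid.powers f))
      ((ModuleCat.of R M).localizedModule (Submonoid.powers f)) :=
    Module.Finite.of_isLocalizedModule (Submonoid.powers f) (restrictToBasicOpenMk f M)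
  exact this

lemma isZero_of_restrictToBasicOpen {s : Set R} (hs : Ideal.span s = ⊤) (M : FGModuleCat.{u} R)
    (h : ∀ f ∈ s, IsZero ((restrictToBasicOpen R f).obj M)) : IsZero M := by
  have hM : ∀ m : M, m = 0 := fun m =>
    Module.eq_zero_of_isLocalized_span s hs _ (fun f => restrictToBasicOpenMk f.1 M) m fun f =>
      have : Subsingleton ((ModuleCat.of R M).localizedModule (Submonoid.powers f.1)) :=
        ModuleCat.subsingleton_of_isZero (h f.1 f.2)
      Subsingleton.elim _ _
  rw [IsZero.iff_id_eq_zero]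
  ext m
  rw [hM m, map_zero, map_zero]

variable [IsNoetherianRing R]

/-- Finitely generated projectivity is local on the spectrum. -/
lemma projective_of_restrictToBasicOpen {s : Set R} (hs : Ideal.span s = ⊤) (M : FGModuleCat.{u} R)
    (h : ∀ f ∈ s, Module.Projective (Localization (Submonoid.powers f))
      ((restrictToBasicOpen R f).obj M)) : Module.Projective R M := by
  have : Module.FinitePresentation R M := Module.finitePresentation_of_finite R M
  rw [← Module.freeLocus_eq_univ_iff]
  refine Set.eq_univ_of_forall fun p => ?_
  obtain ⟨f, hf, hfp⟩ : ∃ f ∈ s, f ∉ p.asIdeal := by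
    by_contra! hsp
    exact p.isPrime.ne_top (top_unique (hs ▸ Ideal.span_le.mpr hsp))
  have : Module.Projective (Localization (Submonoid.powers f))
      ((ModuleCat.of R M).localizedModule (Submonoid.powers f)) := h f hf
  refine Module.basicOpen_subset_freeLocus_iff.mpr ?_ (show p ∈ PrimeSpectrum.basicOpen f from hfp)
  exact Module.Projective.of_equiv (LinearEquiv.extendScalarsOfIsLocalization (Submonoid.powers f)
    (Localization (Submonoid.powers f)) (IsLocalizedModule.linearEquiv (Submonoid.powers f)
    (restrictToBasicOpenMk f M) (LocalizedModule.mkLinearMap (Submonoid.powers f) M)))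

lemma FGModuleCat.exists_epi_of_projective (M : FGModuleCat.{u} R) :
    ∃ (P : FGModuleCat.{u} R) (p : P ⟶ M), Module.Projective R P ∧ Epi p := by
  obtain ⟨P, _, _, _, _, f, hf⟩ := Module.exists_finite_presentation R M
  refine ⟨FGModuleCat.of R P, FGModuleCat.ofHom f, inferInstanceAs (Module.Projective R P), ?_⟩
  exact (forget₂ (FGModuleCat.{u} R) (ModuleCat.{u} R)).epi_of_epi_map
    ((ModuleCat.epi_iff_surjective _).mpr hf)

/-- A strictly perfect complex has projective amplitude bounded below. -/
lemma IsStrictlyPerfect.exists_projAmplitudeGE {R : Type u} [CommRing R]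
    [HasDerivedCategory.{u + 1} (ModuleCat.{u} R)] {L : CochainComplex (ModuleCat.{u} R) ℤ}
    (hL : IsStrictlyPerfect R L) :
    ∃ a, DerivedCategory.ProjAmplitudeGE (DerivedCategory.Q.obj L) a := by
  obtain ⟨⟨a, b, _, _⟩, hp⟩ := hL
  have : ∀ i, Projective (L.X i) := fun i =>
    (IsProjective.iff_projective (L.X i)).mp (hp i).2
  exact ⟨a, DerivedCategory.projAmplitudeGE_Q_obj L a b⟩

variable [HasDerivedCategory.{w} (FGModuleCat.{u} R)]

lemma perfectObjects_singleFunctor_of_projective (P : FGModuleCat.{u} R) [Module.Projective R P] :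
    perfectObjects.{w} R ((DerivedCategory.singleFunctor _ 0).obj P) := by
  refine ⟨boundedObjects_singleFunctor P 0, (CochainComplex.singleFunctor _ 0).obj P,
    ⟨{1}, by simp, ?_⟩, ⟨(DerivedCategory.singleFunctorIsoCompQ _ 0).app P⟩⟩
  rintro f -
  refine ⟨_, ⟨⟨0, 0, ?_, ?_⟩, fun i => ⟨finite_restrictToBasicOpen_obj f _, ?_⟩⟩, 𝟙 _,
    inferInstance⟩
  · infer_instance
  · infer_instance
  · have : Module.Projective R
        (((CochainComplex.singleFunctor (FGModuleCat.{u} R) 0).obj P).X i) := by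
      by_cases hi : i = 0
      · subst hi
        exact .of_equiv (FGModuleCat.isoToLinearEquiv
          (HomologicalComplex.singleObjXSelf (ComplexShape.up ℤ) 0 P).symm)
      · have := (forget₂ (FGModuleCat.{u} R) (ModuleCat.{u} R)).map_isZero
          (HomologicalComplex.isZero_single_obj_X (ComplexShape.up ℤ) 0 P i hi)
        have : Subsingleton (((CochainComplex.singleFunctor (FGModuleCat.{u} R) 0).obj P).X i) :=
          ModuleCat.subsingleton_of_isZero this
        infer_instance
    exact projective_restrictToBasicOpen_obj f _

section

variable [∀ f : R, HasDerivedCategory.{u + 1} (ModuleCat.{u} (Localization (Submonoid.powers f)))]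

/-- The bound on the local projective amplitudes of a perfect complex can be taken uniform, since
finitely many basic open subsets suffice to cover the spectrum. -/
lemma IsPerfectComplex.exists_projAmplitudeGE {K : CochainComplex (FGModuleCat.{u} R) ℤ}
    (hK : IsPerfectComplex R K) : ∃ (s : Set R) (a : ℤ), Ideal.span s = ⊤ ∧ ∀ f ∈ s,
      DerivedCategory.ProjAmplitudeGE ((restrictToBasicOpen R f).mapDerivedCategory.obj
        (DerivedCategory.Q.obj K)) a := by
  obtain ⟨s, hs, h⟩ := hK
  obtain ⟨t, hts, ht⟩ := (Ideal.span_eq_top_iff_finite s).mp hs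
  have h' : ∀ f ∈ t, ∃ a, DerivedCategory.ProjAmplitudeGE
      ((restrictToBasicOpen R f).mapDerivedCategory.obj (DerivedCategory.Q.obj K)) a := by
    intro f hf
    obtain ⟨L, hL, φ, hφ⟩ := h f (hts hf)
    obtain ⟨a, ha⟩ := hL.exists_projAmplitudeGE
    exact ⟨a, ha.of_iso (asIso (DerivedCategory.Q.map φ) ≪≫
      ((restrictToBasicOpen R f).mapDerivedCategoryFactors.app K).symm)⟩
  choose! a ha using h'
  obtain ⟨a₀, ha₀⟩ := (t.image a).bddBelow
  exact ⟨t, a₀, ht, fun f hf => (ha f hf).of_le (ha₀ (Finset.mem_coe.mpr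
    (Finset.mem_image_of_mem a hf)))⟩

/-- A complex of projective amplitude concentrated in one degree is a projective module: locally it
is a direct summand of a projective module. -/
lemma exists_iso_singleFunctor_of_projAmplitudeGE {s : Set R} (hs : Ideal.span s = ⊤) (b : ℤ)
    (X : DerivedCategory (FGModuleCat.{u} R)) [X.IsLE b]
    (h : ∀ f ∈ s, DerivedCategory.ProjAmplitudeGE
      ((restrictToBasicOpen R f).mapDerivedCategory.obj X) b) :
    ∃ Y : FGModuleCat.{u} R, Module.Projective R Y ∧
      Nonempty (X ≅ (DerivedCategory.singleFunctor _ b).obj Y) := by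
  obtain ⟨P, hP, Z, _, _, _, hT, _⟩ :=
    DerivedCategory.exists_triangle_of_isLE X b (FGModuleCat.exists_epi_of_projective (R := R))
  have hPf : ∀ f : R, Projective ((restrictToBasicOpen R f).obj P) := fun f =>
    (IsProjective.iff_projective _).mp (projective_restrictToBasicOpen_obj f P)
  have hr : ∀ f ∈ s, Nonempty (Retract ((restrictToBasicOpen R f).mapDerivedCategory.obj X)
      ((DerivedCategory.singleFunctor _ b).obj ((restrictToBasicOpen R f).obj P))) := by
    intro f hf
    obtain ⟨σ, hσ⟩ := DerivedCategory.ProjAmplitudeGE.exists_section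
      ((restrictToBasicOpen R f).mapDerivedCategory.map_distinguished _ hT) (b := b)
      (DerivedCategory.isLE_mapDerivedCategory_obj _ Z b) (h f hf)
    exact ⟨(Retract.mk σ _ hσ).trans (Retract.ofIso
      (((restrictToBasicOpen R f).mapDerivedCategorySingleFunctor b).app P))⟩
  have hX : X.IsGE b := by
    rw [DerivedCategory.isGE_iff]
    refine fun i hi => isZero_of_restrictToBasicOpen hs _ fun f hf => ?_
    obtain ⟨e⟩ := DerivedCategory.nonempty_homologyFunctor_mapDerivedCategory_iso
      (restrictToBasicOpen R f) X i
    obtain ⟨r⟩ := hr f hf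
    have r' := r.map (DerivedCategory.homologyFunctor _ i)
    exact (IsZero.of_mono r'.i (DerivedCategory.isZero_of_isGE _ b i hi)).of_iso e.symm
  obtain ⟨Y, ⟨eY⟩⟩ := X.exists_iso_singleFunctor_obj_of_isGE_of_isLE b
  refine ⟨Y, projective_of_restrictToBasicOpen hs Y fun f hf => ?_, ⟨eY⟩⟩
  obtain ⟨r⟩ := hr f hf
  have r' := (((Retract.ofIso
    (((restrictToBasicOpen R f).mapDerivedCategorySingleFunctor b).symm.app Y ≪≫
    (restrictToBasicOpen R f).mapDerivedCategory.mapIso eY.symm)).trans r).map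
    (DerivedCategory.homologyFunctor _ b))
  have r'' : Retract ((restrictToBasicOpen R f).obj Y) ((restrictToBasicOpen R f).obj P) :=
    (Retract.ofIso ((DerivedCategory.singleFunctorCompHomologyFunctorIso _ b).symm.app _)).trans
      (r'.trans (Retract.ofIso ((DerivedCategory.singleFunctorCompHomologyFunctorIso _ b).app _)))
  exact (IsProjective.iff_projective _).mpr r''.projective

/-- Induction on the length `n` of the local projective amplitude: replacing `X` by the fibre of a
map from a projective that is onto its top cohomology shortens the amplitude by one. -/
lemma classIn_of_projAmplitudeGE (S : AddSubgroup (RingK₀'.{w} R))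
    (hS : ∀ P : FGModuleCat.{u} R, Module.Projective R P → moduleClass P ∈ S) {s : Set R}
    (hs : Ideal.span s = ⊤) (b : ℤ) (n : ℕ) (X : DerivedCategory (FGModuleCat.{u} R))
    (hX : boundedObjects.{w} R X) (hXb : X.IsLE b)
    (h : ∀ f ∈ s, DerivedCategory.ProjAmplitudeGE
      ((restrictToBasicOpen R f).mapDerivedCategory.obj X) (b - n)) : classIn S X := by
  induction n generalizing X with
  | zero =>
    obtain ⟨Y, hY, ⟨e⟩⟩ := exists_iso_singleFunctor_of_projAmplitudeGE hs b X
      fun f hf => by simpa using h f hf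
    exact classIn_of_iso S e.symm (classIn_singleFunctor S (hS Y hY) b)
  | succ n ih =>
    obtain ⟨P, hP, Z, _, _, _, hT, hZ⟩ :=
      DerivedCategory.exists_triangle_of_isLE X b (FGModuleCat.exists_epi_of_projective (R := R))
    have hZS : classIn S Z := ih Z ((boundedObjects.{w} R).ext_of_isTriangulatedClosed₁ _ hT
      (boundedObjects_singleFunctor P b) hX) hZ fun f hf => by
        have : Projective ((restrictToBasicOpen R f).obj P) :=
          (IsProjective.iff_projective _).mp (projective_restrictToBasicOpen_obj f P)
        have := DerivedCategory.ProjAmplitudeGE.of_triangle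
          ((restrictToBasicOpen R f).mapDerivedCategory.map_distinguished _ hT)
          (b := b) (by push_cast; lia)
          (((restrictToBasicOpen R f).mapDerivedCategorySingleFunctor b).app P) (h f hf)
        exact this.of_le (by push_cast; lia)
    exact classIn_ext₃ S hT hZS (classIn_singleFunctor S (hS P hP) b)

end

/-- The class of a perfect complex is a combination of classes of projective modules. -/
lemma classIn_of_perfectObjects (S : AddSubgroup (RingK₀'.{w} R))
    (hS : ∀ P : FGModuleCat.{u} R, Module.Projective R P → moduleClass P ∈ S)
    {X : DerivedCategory (FGModuleCat.{u} R)} (hX : perfectObjects.{w} R X) : classIn S X := by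
  let (f : R) : HasDerivedCategory.{u + 1} (ModuleCat.{u} (Localization (Submonoid.powers f))) :=
    HasDerivedCategory.standard _
  obtain ⟨hXb, K, hK, ⟨e⟩⟩ := hX
  obtain ⟨s, a, hs, h⟩ := hK.exists_projAmplitudeGE
  obtain ⟨b, hb⟩ := hXb.2
  refine classIn_of_projAmplitudeGE S hS hs b (b - a).toNat X hXb hb fun f hf => ?_
  exact ((h f hf).of_iso ((restrictToBasicOpen R f).mapDerivedCategory.mapIso e.symm)).of_le
    (by lia)

end Perfect

/-! ### Modules over a square-zero extension -/

section ProjectiveClasses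

variable {R : Type u} [CommRing R] [IsNoetherianRing R]
  [HasDerivedCategory.{w} (FGModuleCat.{u} R)]

lemma moduleClass_mem_range_of_projective (P : FGModuleCat.{u} R) [Module.Projective R P] :
    moduleClass P ∈ (ringK₀Inclusion.{w} R).range :=
  ⟨TriangulatedKTheory.K₀.mk _ (perfectObjects_singleFunctor_of_projective P), rfl⟩

/-- If multiplication by `z` on `P` has kernel `zP`, then both graded pieces of the filtration
`0 ⊆ zP ⊆ P` are isomorphic to `P/zP`. -/
lemma moduleClass_eq_two_nsmul {P M : Type u} [AddCommGroup P] [Module R P] [Module.Finite R P]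
    [AddCommGroup M] [Module R M] [Module.Finite R M] (z : R)
    (hz : Function.Exact (LinearMap.lsmul R P z) (LinearMap.lsmul R P z)) (g : P →ₗ[R] M)
    (hg : Function.Surjective g) (hzg : Function.Exact (LinearMap.lsmul R P z) g) :
    moduleClass.{w} (FGModuleCat.of R P) = 2 • moduleClass (FGModuleCat.of R M) := by
  have e : LinearMap.range (LinearMap.lsmul R P z) ≃ₗ[R] M :=
    (LinearMap.quotKerEquivRange _).symm.trans
      ((Submodule.quotEquivOfEq _ _ (hz.linearMap_ker_eq.trans hzg.linearMap_ker_eq.symm)).trans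
        (g.quotKerEquivOfSurjective hg))
  rw [moduleClass_of_eq_add (LinearMap.range (LinearMap.lsmul R P z)).subtype g
    (Submodule.subtype_injective _) ?_ hg, moduleClass_of_linearEquiv e, two_nsmul]
  rw [LinearMap.exact_iff, Submodule.range_subtype, hzg.linearMap_ker_eq]

end ProjectiveClasses

/-- If the annihilator of `z` in `B` is `(z)`, the same holds on free modules, hence on their direct
summands. -/
lemma Module.Projective.exact_lsmul {B P : Type*} [CommRing B] [AddCommGroup P] [Module B P]
    [Module.Projective B P] {z : B} (hz : ∀ b, z * b = 0 ↔ z ∣ b) :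
    Function.Exact (LinearMap.lsmul B P z) (LinearMap.lsmul B P z) := by
  obtain ⟨s, hs⟩ := Module.projective_def.mp ‹Module.Projective B P›
  intro p
  constructor
  · intro hp
    have h : ∀ i, ∃ c, s p i = z * c := fun i => (hz _).mp <| by
      have := congrArg (fun q => s q i) hp
      simpa using this
    choose c hc using h
    refine ⟨∑ i ∈ (s p).support, c i • i, ?_⟩
    conv_rhs => rw [← hs p]
    simp [Finsupp.linearCombination_apply, Finsupp.sum, hc, mul_smul, smul_comm z]
  · rintro ⟨q, rfl⟩
    simp [smul_smul, (hz z).mpr dvd_rfl]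

open scoped TensorProduct

section SquareZeroExtension

variable {A B : Type u} [CommRing A] [CommRing B] [Algebra A B]

/-- For a retraction `π : B → A` with kernel `(z)`, an `A`-module is a `B`-module killed by `z`. -/
lemma exists_module_of_retraction (π : B →ₐ[A] A) {z : B} (hπ : RingHom.ker π = Ideal.span {z})
    (N : Type*) [AddCommGroup N] [Module A N] :
    ∃ _ : Module B N, IsScalarTower A B N ∧ ∀ n : N, z • n = 0 := by
  have hz : π z = 0 := by
    rw [← RingHom.mem_ker, hπ]
    exact Ideal.mem_span_singleton_self z
  let _ : Module B N := Module.compHom N π.toRingHom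
  refine ⟨inferInstance, ⟨fun a b n => ?_⟩, fun n => ?_⟩
  · change π (a • b) • n = a • π b • n
    rw [map_smul, smul_assoc]
  · change π z • n = 0
    rw [hz, zero_smul]

section

variable {M N : Type*} [AddCommGroup M] [Module A M] [Module B M] [IsScalarTower A B M]
  [AddCommGroup N] [Module A N] [Module B N] [IsScalarTower A B N]

lemma smul_eq_retraction_smul {π : B →ₐ[A] A} {z : B} (hπ : RingHom.ker π = Ideal.span {z})
    (hM : ∀ m : M, z • m = 0) (b : B) (m : M) : b • m = π b • m := by
  have hb : b - algebraMap A B (π b) ∈ RingHom.ker π := by simp [RingHom.mem_ker]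
  rw [hπ, Ideal.mem_span_singleton'] at hb
  obtain ⟨c, hc⟩ := hb
  rw [← sub_eq_zero, ← algebraMap_smul B (π b) m, ← sub_smul, ← hc, mul_smul, hM, smul_zero]

/-- An `A`-linear map between modules killed by `z`, as a `B`-linear map. -/
def LinearMap.ofRetraction {π : B →ₐ[A] A} {z : B} (hπ : RingHom.ker π = Ideal.span {z})
    (hM : ∀ m : M, z • m = 0) (hN : ∀ n : N, z • n = 0) (f : M →ₗ[A] N) : M →ₗ[B] N where
  toFun := f
  map_add' := f.map_add
  map_smul' b m := by
    rw [smul_eq_retraction_smul hπ hM, smul_eq_retraction_smul hπ hN, f.map_smul, RingHom.id_apply]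

/-- The `B`-linear map `B ⊗[A] M → M`, `b ⊗ m ↦ b • m`, for a module `M` killed by `z`, is
surjective with kernel `z (B ⊗[A] M)`, since `B --z--> B --π--> A → 0` is exact. -/
lemma exact_lsmul_liftBaseChange {π : B →ₐ[A] A} {z : B}
    (hπ : RingHom.ker π = Ideal.span {z}) (hM : ∀ m : M, z • m = 0) :
    Function.Exact (LinearMap.lsmul B (B ⊗[A] M) z)
      (LinearMap.liftBaseChange B (LinearMap.id : M →ₗ[A] M)) := by
  have hex : Function.Exact (LinearMap.mulLeft A z) π.toLinearMap := fun b => by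
    rw [AlgHom.toLinearMap_apply, ← RingHom.mem_ker, hπ, Ideal.mem_span_singleton]
    exact ⟨fun ⟨c, hc⟩ => ⟨c, hc.symm⟩, fun ⟨c, hc⟩ => ⟨c, hc.symm⟩⟩
  have hsurj : Function.Surjective π.toLinearMap := fun a => ⟨algebraMap A B a, by simp⟩
  have h := rTensor_exact M hex hsurj
  have h₁ : ∀ x, LinearMap.rTensor M (LinearMap.mulLeft A z) x = z • x := fun x => by
    induction x with
    | zero => simp
    | tmul b m => simp [TensorProduct.smul_tmul']
    | add x y hx hy => rw [map_add, hx, hy, smul_add]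
  have h₂ : ∀ x, TensorProduct.lid A M (LinearMap.rTensor M π.toLinearMap x) =
      LinearMap.liftBaseChange B (LinearMap.id : M →ₗ[A] M) x := fun x => by
    induction x with
    | zero => simp
    | tmul b m => simp [smul_eq_retraction_smul hπ hM b m]
    | add x y hx hy => rw [map_add, map_add, map_add, hx, hy]
  intro x
  rw [← h₂, LinearEquiv.map_eq_zero_iff, h x]
  exact exists_congr fun y => by rw [h₁]; rfl

end

variable [IsNoetherianRing B] [HasDerivedCategory.{w} (FGModuleCat.{u} B)]

/-- Twice the class of `M` is the class of the projective `B`-module `B ⊗[A] M`. -/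
lemma two_nsmul_moduleClass_mem_range_of_projective {π : B →ₐ[A] A} {z : B}
    (hπ : RingHom.ker π = Ideal.span {z}) (hz : ∀ b, z * b = 0 ↔ z ∣ b) (M : Type u)
    [AddCommGroup M] [Module A M] [Module B M] [IsScalarTower A B M] [Module.Finite A M]
    [Module.Finite B M] [Module.Projective A M] (hM : ∀ m : M, z • m = 0) :
    2 • moduleClass (FGModuleCat.of B M) ∈ (ringK₀Inclusion.{w} B).range := by
  rw [← moduleClass_eq_two_nsmul z (Module.Projective.exact_lsmul (P := B ⊗[A] M) hz)
    (LinearMap.liftBaseChange B (LinearMap.id : M →ₗ[A] M)) (fun m => ⟨1 ⊗ₜ m, by simp⟩)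
    (exact_lsmul_liftBaseChange hπ hM)]
  have : Module.Projective B (FGModuleCat.of B (B ⊗[A] M)) :=
    inferInstanceAs (Module.Projective B (B ⊗[A] M))
  exact moduleClass_mem_range_of_projective _

/-- A finite projective resolution over `A` reduces the claim to projective `A`-modules. -/
lemma two_nsmul_moduleClass_mem_range_of_hasProjectiveDimensionLE [IsNoetherianRing A]
    {π : B →ₐ[A] A} {z : B}
    (hπ : RingHom.ker π = Ideal.span {z}) (hz : ∀ b, z * b = 0 ↔ z ∣ b) (n : ℕ) (M : Type u)
    [AddCommGroup M] [Module A M] [Module B M] [IsScalarTower A B M] [Module.Finite A M]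
    [Module.Finite B M] (hM : ∀ m : M, z • m = 0)
    (hn : HasProjectiveDimensionLE (ModuleCat.of A M) n) :
    2 • moduleClass (FGModuleCat.of B M) ∈ (ringK₀Inclusion.{w} B).range := by
  induction n generalizing M with
  | zero =>
    rw [← projective_iff_hasProjectiveDimensionLE_zero, ← IsProjective.iff_projective] at hn
    exact two_nsmul_moduleClass_mem_range_of_projective hπ hz M hM
  | succ n ih =>
    obtain ⟨F, _, _, _, _, f, hf⟩ := Module.exists_finite_presentation A M
    obtain ⟨_, _, hF⟩ := exists_module_of_retraction π hπ F
    obtain ⟨_, _, hK⟩ := exists_module_of_retraction π hπ (LinearMap.ker f)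
    have : Module.Finite B F := .of_restrictScalars_finite A B F
    have : Module.Finite B (LinearMap.ker f) := .of_restrictScalars_finite A B _
    have hP : Projective (ModuleCat.of A F) :=
      (IsProjective.iff_projective (ModuleCat.of A F)).mp (inferInstanceAs (Module.Projective A F))
    have hKn : HasProjectiveDimensionLE (ModuleCat.of A (LinearMap.ker f)) n :=
      ((LinearMap.shortExact_shortComplexKer hf).hasProjectiveDimensionLT_X₃_iff n hP).mp hn
    have h := moduleClass_of_eq_add.{w} (.ofRetraction hπ hK hF (LinearMap.ker f).subtype)
      (.ofRetraction hπ hF hM f) (Submodule.subtype_injective _)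
      (LinearMap.exact_subtype_ker_map f) hf
    have h' := congrArg (2 • ·) h
    simp only [nsmul_add] at h'
    refine ((AddSubgroup.add_mem_cancel_left _ (ih _ hK hKn)).mp ?_)
    rw [← h']
    exact two_nsmul_moduleClass_mem_range_of_projective hπ hz F hF

/-- The image of `K₀` in `K₀'` for a square-zero extension `B` of a regular ring `A` by a principal
ideal `(z)` that is its own annihilator. -/
theorem range_ringK₀Inclusion_of_retraction [IsRegularRing A] {π : B →ₐ[A] A} {z : B}
    (hπ : RingHom.ker π = Ideal.span {z}) (hz : ∀ b, z * b = 0 ↔ z ∣ b) :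
    (ringK₀Inclusion.{w} B).range =
      (nsmulAddMonoidHom 2 : RingK₀'.{w} B →+ RingK₀'.{w} B).range := by
  apply le_antisymm
  · rintro _ ⟨x, rfl⟩
    induction x using TriangulatedKTheory.K₀.induction_on with
    | mk X hX =>
      refine (classIn_of_perfectObjects _ (fun P _ => ?_) hX).2
      refine ⟨moduleClass (FGModuleCat.of B
        (P ⧸ LinearMap.range (LinearMap.lsmul B P z))), ?_⟩
      exact (moduleClass_eq_two_nsmul z (Module.Projective.exact_lsmul hz) (Submodule.mkQ _)
        (Submodule.mkQ_surjective _) (LinearMap.exact_map_mkQ_range _)).symm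
    | zero => exact map_zero (ringK₀Inclusion.{w} B) ▸ zero_mem _
    | neg x hx => exact map_neg (ringK₀Inclusion.{w} B) x ▸ neg_mem hx
    | add x y hx hy => exact map_add (ringK₀Inclusion.{w} B) x y ▸ add_mem hx hy
  · have h := eq_top_of_moduleClass_mem ((ringK₀Inclusion.{w} B).range.comap (nsmulAddMonoidHom 2))
      fun M => ?_
    · rintro _ ⟨x, rfl⟩
      exact (h ▸ AddSubgroup.mem_top x : x ∈ (ringK₀Inclusion.{w} B).range.comap _)
    have hzz : ∀ m : M, z • z • m = 0 := fun m => by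
      rw [smul_smul, (hz z).mpr dvd_rfl, zero_smul]
    have key : ∀ (N : Type u) [AddCommGroup N] [Module B N] [Module.Finite B N],
        (∀ n : N, z • n = 0) →
        2 • moduleClass (FGModuleCat.of B N) ∈ (ringK₀Inclusion.{w} B).range := by
      intro N _ _ _ hN
      let _ : Module A N := Module.compHom N (algebraMap A B)
      have : IsScalarTower A B N := .of_algebraMap_smul fun _ _ => rfl
      have : Module.Finite A N := Module.Finite.of_surjective (σ := (π : B →+* A))
        { toFun := id, map_add' := fun _ _ => rfl,
          map_smul' := smul_eq_retraction_smul hπ hN : N →ₛₗ[(π : B →+* A)] N }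
        Function.surjective_id
      obtain ⟨n, hn⟩ := IsRegularRing.exists_hasProjectiveDimensionLE (ModuleCat.of A N)
      exact two_nsmul_moduleClass_mem_range_of_hasProjectiveDimensionLE hπ hz n N hN hn
    -- Both graded pieces of the filtration `0 ⊆ zM ⊆ M` are killed by `z`.
    let φ := LinearMap.lsmul B M z
    have h := moduleClass_of_eq_add.{w} (LinearMap.range φ).subtype (LinearMap.range φ).mkQ
      (Submodule.subtype_injective _) (LinearMap.exact_subtype_mkQ _) (Submodule.mkQ_surjective _)
    change 2 • moduleClass (FGModuleCat.of B M) ∈ (ringK₀Inclusion.{w} B).range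
    rw [h, nsmul_add]
    refine add_mem (key _ ?_) (key _ ?_)
    · rintro ⟨_, m, rfl⟩
      exact Subtype.ext (hzz m)
    · intro m
      obtain ⟨m, rfl⟩ := Submodule.mkQ_surjective _ m
      rw [← map_smul]
      exact (Submodule.Quotient.mk_eq_zero _).mpr ⟨m, rfl⟩

end SquareZeroExtension

section DualNumbers

open Polynomial

variable (A : Type u) [CommRing A]

/-- The retraction `A[z]/(z²) → A`, `z ↦ 0`. -/
noncomputable def DualNumbersOver.retraction : DualNumbersOver A →ₐ[A] A :=
  Ideal.Quotient.liftₐ _ (aeval (0 : A)) <| by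
    change Ideal.span _ ≤ RingHom.ker (aeval (0 : A))
    rw [Ideal.span_le]
    rintro _ rfl
    simp [RingHom.mem_ker]

lemma DualNumbersOver.ker_retraction : RingHom.ker (DualNumbersOver.retraction A) =
    Ideal.span {(Ideal.Quotient.mk _ X : DualNumbersOver A)} := by
  ext b
  obtain ⟨p, rfl⟩ := Ideal.Quotient.mk_surjective b
  have h : DualNumbersOver.retraction A (Ideal.Quotient.mk _ p) = p.coeff 0 := by
    simp [DualNumbersOver.retraction, coeff_zero_eq_aeval_zero]
  rw [RingHom.mem_ker, h, ← X_dvd_iff, Ideal.mem_span_singleton]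
  refine ⟨fun h => map_dvd _ h, fun ⟨c, hc⟩ => ?_⟩
  obtain ⟨q, rfl⟩ := Ideal.Quotient.mk_surjective c
  rw [← map_mul, Ideal.Quotient.eq, Ideal.mem_span_singleton] at hc
  obtain ⟨r, hr⟩ := hc
  exact ⟨q + X * r, by linear_combination hr⟩

lemma DualNumbersOver.mk_X_mul_eq_zero_iff (b : DualNumbersOver A) :
    (Ideal.Quotient.mk _ X : DualNumbersOver A) * b = 0 ↔ (Ideal.Quotient.mk _ X) ∣ b := by
  obtain ⟨p, rfl⟩ := Ideal.Quotient.mk_surjective b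
  rw [← map_mul, Ideal.Quotient.eq_zero_iff_mem, Ideal.mem_span_singleton]
  constructor
  · rintro ⟨q, hq⟩
    refine ⟨Ideal.Quotient.mk _ q, ?_⟩
    rw [← map_mul, isRegular_X.left (show X * p = X * (X * q) by rw [hq]; ring)]
  · rintro ⟨c, hc⟩
    obtain ⟨q, rfl⟩ := Ideal.Quotient.mk_surjective c
    rw [← map_mul, Ideal.Quotient.eq, Ideal.mem_span_singleton] at hc
    obtain ⟨r, hr⟩ := hc
    exact ⟨q + X * r, by linear_combination X * hr⟩

end DualNumbers

theorem proposition4p5 (A : Type u) [CommRing A] [IsRegularRing A]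
    [HasDerivedCategory.{w} (FGModuleCat.{u} (DualNumbersOver A))] :
    (ringK₀Inclusion.{w} (DualNumbersOver A)).range =
      (nsmulAddMonoidHom 2 : RingK₀'.{w} (DualNumbersOver A) →+
        RingK₀'.{w} (DualNumbersOver A)).range :=
  range_ringK₀Inclusion_of_retraction (DualNumbersOver.ker_retraction A)
    (DualNumbersOver.mk_X_mul_eq_zero_iff A)
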